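/- Let $P\subset\mathbb{R}^2$ be a polygon homeomorphic to a closed disk, with (finite) vertex set $\mathcal V_P$, let $S_1,\dots,S_m$ be contracting similarities of the plane, and put $P_i=S_i(P)$ and $\mathcal V_{P_i}=S_i(\mathcal V_P)$. Suppose that $\mathcal S=\{S_1,\dots,S_m\}$ is a generalized $P$-polygonal system, that is (the inclusions $P_i\subset P$ not being required): (D2) for any $i\neq j$, $P_i\cap P_j=\mathcal V_{P_i}\cap\mathcal V_{P_j}$, and this set has fewer than two points; (D3) $\mathcal V_P\subset\bigcup_{i=1}^m S_i(\mathcal V_P)$; (D4) the set $\bigcup_{i=1}^m P_i$ is contractible. Let $K$ be the attractor of $\mathcal S$, i.e. the nonempty compact set with $K=\bigcup_{i=1}^m S_i(K)$. If $S_i(K)\cap S_j(K)=P_i\cap P_j$ for all $i\neq j$, then $K$ is a dendrite, i.e. a locally connected continuum (nonempty compact connected set) containing no simple closed curve. -/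

import Mathlib

/-- A polygon in the plane that is homeomorphic to a disk: at least three distinct vertices, listed
in cyclic order, such that two distinct edges meet at most in common endpoints, together with
the closed region `carrier` that is bounded by these edges and is homeomorphic to a closed disk. -/
structure PolygonalDisk where
  /-- the number of vertices -/
  n : ℕ
  three_le : 3 ≤ n
  /-- the vertices in cyclic order; `finRotate n` is the cyclic successor on `Fin n`, and
  `poly.edgeSet ℝ i` is the closed segment from `poly i` to `poly (finRotate n i)` -/
  poly : Polygon ℂ n
  vertices_injective : Function.Injective poly.vertices
  edge_inter : ∀ i j : Fin n, i ≠ j →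
    poly.edgeSet ℝ i ∩ poly.edgeSet ℝ j ⊆
      {poly i, poly (finRotate n i)} ∩ {poly j, poly (finRotate n j)}
  /-- the closed region -/
  carrier : Set ℂ
  frontier_carrier : frontier carrier = poly.boundary ℝ
  homeomorphic_disk : Nonempty (carrier ≃ₜ Metric.closedBall (0 : ℂ) 1)

/-- The set of vertices of a polygon. -/
def PolygonalDisk.vertexSet (P : PolygonalDisk) : Set ℂ := Set.range P.poly.vertices

/-- A contracting similarity of the plane. -/
def IsContractingSimilarity (f : ℂ → ℂ) : Prop :=
  ∃ q : ℝ, 0 < q ∧ q < 1 ∧ ∀ z w : ℂ, dist (f z) (f w) = q * dist z w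

/-- A generalized `P`-polygonal system of similarities. -/
structure IsGeneralizedPolygonalSystem {m : ℕ} (P : PolygonalDisk) (S : Fin m → ℂ → ℂ) : Prop where
  similarity : ∀ i, IsContractingSimilarity (S i)
  /-- distinct pieces `S i '' P` meet only in common vertices -/
  inter_eq : ∀ i j, i ≠ j →
    S i '' P.carrier ∩ S j '' P.carrier = S i '' P.vertexSet ∩ S j '' P.vertexSet
  /-- distinct pieces have at most one common vertex -/
  common_vertices : ∀ i j, i ≠ j → (S i '' P.vertexSet ∩ S j '' P.vertexSet).Subsingleton
  /-- each vertex of `P` is a vertex of some piece -/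
  vertexSet_subset : P.vertexSet ⊆ ⋃ i, S i '' P.vertexSet
  /-- the union of the pieces is contractible -/
  contractible : ContractibleSpace (⋃ i, S i '' P.carrier : Set ℂ)

/-- `K` is the attractor of the finite system `S` (for a system of contractions
there is exactly one such set). -/
structure IsAttractor {m : ℕ} (S : Fin m → ℂ → ℂ) (K : Set ℂ) : Prop where
  nonempty : K.Nonempty
  isCompact : IsCompact K
  eq_iUnion : K = ⋃ i, S i '' K

/-- A subset of the plane is a dendrite if it is a locally connected continuum
(a nonempty compact connected set) that contains no simple closed curve. -/
structure IsDendrite (K : Set ℂ) : Prop where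
  isCompact : IsCompact K
  isConnected : IsConnected K
  locallyConnected : LocallyConnectedSpace K
  no_simple_closed_curve :
    ¬ ∃ γ : Circle → ℂ, Continuous γ ∧ Function.Injective γ ∧ Set.range γ ⊆ K

open Set Topology

/-! ### Contractible unions contain no rings of pieces -/

section Contractible

variable {X : Type*} [TopologicalSpace X]

/-- A continuous map from a contractible space to the circle has a continuous logarithm. -/
theorem ContractibleSpace.exists_circle_exp_lift [ContractibleSpace X] (f : C(X, Circle)) :
    ∃ g : C(X, ℝ), ∀ x, Circle.exp (g x) = f x := by
  obtain ⟨p, ⟨H⟩⟩ := id_nullhomotopic X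
  obtain ⟨r, hr⟩ := Circle.exp_surjective (f p)
  -- The reversed contraction runs from the constant `p` to the identity, so the constant `r` lifts
  -- its start and time 1 lifts `f`.
  let G : C(unitInterval × X, Circle) := f.comp H.symm.toContinuousMap
  have hG0 : ∀ a, G (0, a) = Circle.exp (ContinuousMap.const X r a) := by
    intro a
    simp [G, hr]
  let L := Circle.isCoveringMap_exp.liftHomotopy G (ContinuousMap.const X r) hG0
  refine ⟨⟨fun x => L (1, x), by fun_prop⟩, fun x => ?_⟩
  have := congr_fun (Circle.isCoveringMap_exp.liftHomotopy_lifts G (ContinuousMap.const X r) hG0)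
    (1, x)
  exact this.trans (by simp [G])

/-- If a contractible space is covered by two closed sets with finite intersection, the first of
them preconnected, then a preconnected subset of the second meets the first in at most one
point. -/
theorem ContractibleSpace.subsingleton_inter_of_finite [T4Space X] [ContractibleSpace X]
    {A B C : Set X} (hA : IsClosed A) (hB : IsClosed B) (hAB : A ∪ B = univ)
    (hfin : (A ∩ B).Finite) (hAc : IsPreconnected A) (hCc : IsPreconnected C) (hCB : C ⊆ B) :
    (C ∩ A).Subsingleton := by
  classical
  rintro p ⟨hpC, hpA⟩ p' ⟨hpC', hpA'⟩
  by_contra hne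
  obtain ⟨g, hg0, hg1, -⟩ := exists_continuous_zero_one_of_isClosed
    (s := (A ∩ B) \ {p}) (t := {p}) hfin.sdiff.isClosed isClosed_singleton disjoint_sdiff_left
  have hgp : g p = 1 := hg1 rfl
  have hgp' : g p' = 0 := hg0 ⟨⟨hpA', hCB hpC'⟩, fun h => hne h.symm⟩
  -- On `A ∩ B` the function `g` is 0 or 1, so both formulas agree there. A logarithm `F` of `f` is
  -- constant on `C`, and `F - 2πg` is constant on `A`, forcing `g p = g p'`.
  let f : X → Circle := fun x => if x ∈ A then Circle.exp (2 * Real.pi * g x) else 1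
  have hfA : ∀ x ∈ A, f x = Circle.exp (2 * Real.pi * g x) := fun x hx => if_pos hx
  have hfB : ∀ x ∈ B, f x = 1 := by
    intro x hx
    by_cases hxA : x ∈ A
    · rw [hfA x hxA]
      by_cases hxp : x = p
      · simp [hxp, hgp]
      · have : g x = 0 := hg0 ⟨⟨hxA, hx⟩, hxp⟩
        simp [this]
    · exact if_neg hxA
  have hf : Continuous f := by
    rw [← continuousOn_univ, ← hAB]
    refine ContinuousOn.union_of_isClosed ?_ ?_ hA hB
    · exact ContinuousOn.congr (by fun_prop) hfA
    · exact ContinuousOn.congr continuousOn_const hfB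
  obtain ⟨F, hF⟩ := ContractibleSpace.exists_circle_exp_lift ⟨f, hf⟩
  have hF' : ∀ x, Circle.exp (F x) = f x := hF
  have h1 : F p = F p' := Circle.isCoveringMap_exp.constOn_of_comp hCc F.continuous.continuousOn
    (fun a ha b hb => by rw [hF', hF', hfB a (hCB ha), hfB b (hCB hb)]) hpC hpC'
  have h2 : F p - 2 * Real.pi * g p = F p' - 2 * Real.pi * g p' :=
    Circle.isCoveringMap_exp.constOn_of_comp (g := fun x => F x - 2 * Real.pi * g x) hAc
      (by fun_prop)
      (fun a ha b hb => by
        simp only [Circle.exp_sub, hF', hfA a ha, hfA b hb, div_self']) hpA hpA'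
  rw [h1, hgp, hgp'] at h2
  have := Real.pi_pos
  linarith

variable {ι : Type*}

/-- The indices can be split into two classes, separating any two given ones, whose unions meet
in at most one point. -/
def PointSeparated (A : ι → Set X) : Prop :=
  ∀ i j, i ≠ j → ∃ J : Set ι, j ∈ J ∧ i ∉ J ∧ ∃ T : Set X, T.Subsingleton ∧
    ∀ k ∈ J, ∀ l ∉ J, A k ∩ A l ⊆ T

/-- Once `Q i` is removed, the component of the rest that meets `Q j` consists of whole members and
touches the other members only through `Q i`, in at most one point. -/
theorem ContractibleSpace.pointSeparated [Finite ι] [T4Space X] [ContractibleSpace X]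
    {Q : ι → Set X} (hcl : ∀ i, IsClosed (Q i)) (hconn : ∀ i, IsConnected (Q i))
    (hcover : ⋃ i, Q i = univ) (hinter : ∀ i j, i ≠ j → (Q i ∩ Q j).Subsingleton) :
    PointSeparated Q := by
  intro i j hij
  obtain ⟨x, hx⟩ := (hconn j).nonempty
  let B : Set X := ⋃ k ∈ {k | k ≠ i}, Q k
  have hB : ∀ k ≠ i, Q k ⊆ B := fun k hk => subset_biUnion_of_mem (u := Q) hk
  let C := connectedComponentIn B x
  have hQC : ∀ k ≠ i, (Q k ∩ C).Nonempty → Q k ⊆ C := by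
    rintro k hk ⟨y, hyk, hyC⟩
    have := (hconn k).isPreconnected.subset_connectedComponentIn hyk (hB k hk)
    exact this.trans (connectedComponentIn_eq hyC).ge
  have hCsub : (C ∩ Q i).Subsingleton := by
    refine ContractibleSpace.subsingleton_inter_of_finite (hcl i)
      ((toFinite {k | k ≠ i}).isClosed_biUnion fun k _ => hcl k) ?_ ?_ (hconn i).isPreconnected
      isPreconnected_connectedComponentIn (connectedComponentIn_subset B x)
    · rw [← univ_subset_iff, ← hcover]
      refine iUnion_subset fun k => ?_
      by_cases hk : k = i
      · exact hk ▸ subset_union_left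
      · exact (hB k hk).trans subset_union_right
    · simp only [inter_iUnion]
      exact (toFinite {k | k ≠ i}).biUnion fun k hk => (hinter i k (Ne.symm hk)).finite
  refine ⟨{k | k ≠ i ∧ Q k ⊆ C}, ⟨hij.symm, ?_⟩, fun h => h.1 rfl, C ∩ Q i, hCsub, ?_⟩
  · exact hQC j hij.symm ⟨x, hx, mem_connectedComponentIn (hB j hij.symm hx)⟩
  · rintro k ⟨hk, hkC⟩ l hl z ⟨hzk, hzl⟩
    by_cases hli : l = i
    · exact ⟨hkC hzk, hli ▸ hzl⟩
    · exact absurd ⟨hli, hQC l hli ⟨z, hzl, hkC hzk⟩⟩ hl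

theorem pointSeparated_of_contractible_iUnion [Finite ι] {E : Type*} [MetricSpace E]
    {Q : ι → Set E} (hcl : ∀ i, IsClosed (Q i)) (hconn : ∀ i, IsConnected (Q i))
    (hcontr : ContractibleSpace (⋃ i, Q i : Set E))
    (hinter : ∀ i j, i ≠ j → (Q i ∩ Q j).Subsingleton) : PointSeparated Q := by
  have himg : ∀ i, ((↑) : (⋃ i, Q i : Set E) → E) '' ((↑) ⁻¹' Q i) = Q i := fun i => by
    rw [Subtype.image_preimage_coe, inter_eq_right]
    exact subset_iUnion Q i
  have h := ContractibleSpace.pointSeparated (X := (⋃ i, Q i : Set E))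
    (Q := fun i => (↑) ⁻¹' Q i) (fun i => (hcl i).preimage continuous_subtype_val)
    (fun i => ⟨((himg i).symm ▸ (hconn i).nonempty).of_image,
      IsInducing.subtypeVal.isPreconnected_image.1 (by rw [himg i]; exact (hconn i).2)⟩)
    (by rw [← preimage_iUnion]; exact Subtype.coe_preimage_self _)
    (fun i j hij x hx y hy => Subtype.ext (hinter i j hij (by exact hx) (by exact hy)))
  intro i j hij
  obtain ⟨J, hj, hi, T, hT, hJ⟩ := h i j hij
  refine ⟨J, hj, hi, (↑) '' T, hT.image _, fun k hk l hl z hz => ?_⟩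
  exact ⟨⟨z, mem_iUnion.2 ⟨k, hz.1⟩⟩, hJ k hk l hl hz, rfl⟩

end Contractible

/-! ### Simple closed curves and cut points -/

section Circle

instance Circle.instNontrivial : Nontrivial Circle :=
  ⟨1, Circle.exp Real.pi, fun h => by
    simpa [Complex.ext_iff, eq_neg_iff_add_eq_zero] using congrArg Subtype.val h⟩

/-- The circle has no cut points. -/
theorem Circle.eq_univ_or_eq_univ_of_subsingleton_inter {D E : Set Circle} (hD : IsClosed D)
    (hE : IsClosed E) (hDE : D ∪ E = univ) (hsub : (D ∩ E).Subsingleton) :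
    D = univ ∨ E = univ := by
  obtain ⟨t, ht⟩ : ∃ t, D ∩ E ⊆ {t} := by
    rcases hsub.eq_empty_or_singleton with h | ⟨t, h⟩
    · exact ⟨1, by simp [h]⟩
    · exact ⟨t, h.le⟩
  have hcompl := isPreconnected_iff_subset_of_disjoint_closed.1
    (Circle.isPathConnected_compl_singleton t).isConnected.isPreconnected D E hD hE
    (hDE ▸ subset_univ _) (by
      rw [← disjoint_iff_inter_eq_empty]
      exact disjoint_compl_left.mono_right ht)
  -- A connected nontrivial space of this kind has no isolated points, so the complement of `t` is
  -- dense.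
  have := Circle.exp_surjective.connectedSpace Circle.exp.continuous
  have hdense := (dense_compl_singleton t).closure_eq
  exact hcompl.imp (fun h => univ_subset_iff.1 (hdense ▸ closure_minimal h hD))
    (fun h => univ_subset_iff.1 (hdense ▸ closure_minimal h hE))

/-- A simple closed curve in a union of closed sets that are pairwise separated by points lies in
one of these sets. -/
theorem PointSeparated.exists_range_subset {X ι : Type*} [TopologicalSpace X] [Finite ι]
    {A : ι → Set X} (hA : PointSeparated A) (hcl : ∀ i, IsClosed (A i)) {γ : Circle → X}
    (hγ : Continuous γ) (hinj : Function.Injective γ) (hsub : range γ ⊆ ⋃ i, A i) :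
    ∃ i, range γ ⊆ A i := by
  classical
  have := Fintype.ofFinite ι
  suffices H : ∀ I : Finset ι, range γ ⊆ ⋃ i ∈ I, A i → ∃ i, range γ ⊆ A i from
    H Finset.univ (by simpa using hsub)
  intro I
  induction I using Finset.strongInduction with
  | H I ih =>
    intro hI
    obtain ⟨i, hi, -⟩ := mem_iUnion₂.1 (hI (mem_range_self 1))
    by_cases hall : ∀ j ∈ I, j = i
    · refine ⟨i, hI.trans (iUnion₂_subset fun j hj => (hall j hj) ▸ subset_rfl)⟩
    push Not at hall
    obtain ⟨j, hj, hji⟩ := hall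
    obtain ⟨J, hjJ, hiJ, T, hT, hJ⟩ := hA i j hji.symm
    -- Both halves of `I` cut out by `J` are proper, since one omits `i` and the other `j`.
    have key := Circle.eq_univ_or_eq_univ_of_subsingleton_inter
      (D := γ ⁻¹' ⋃ k ∈ I.filter (· ∈ J), A k) (E := γ ⁻¹' ⋃ k ∈ I.filter (· ∉ J), A k)
      ((isClosed_biUnion_finset fun k _ => hcl k).preimage hγ)
      ((isClosed_biUnion_finset fun k _ => hcl k).preimage hγ) ?_ ?_
    · rcases key with h | h
      · refine ih (I.filter (· ∈ J)) (Finset.filter_ssubset.2 ⟨i, hi, hiJ⟩) ?_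
        rintro _ ⟨t, rfl⟩
        exact h.ge (mem_univ t)
      · refine ih (I.filter (· ∉ J)) (Finset.filter_ssubset.2 ⟨j, hj, not_not.2 hjJ⟩) ?_
        rintro _ ⟨t, rfl⟩
        exact h.ge (mem_univ t)
    · refine eq_univ_of_forall fun t => ?_
      obtain ⟨k, hk, hkt⟩ := mem_iUnion₂.1 (hI (mem_range_self t))
      by_cases hkJ : k ∈ J
      · exact Or.inl (mem_iUnion₂.2 ⟨k, Finset.mem_filter.2 ⟨hk, hkJ⟩, hkt⟩)
      · exact Or.inr (mem_iUnion₂.2 ⟨k, Finset.mem_filter.2 ⟨hk, hkJ⟩, hkt⟩)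
    · refine (hT.preimage hinj).anti ?_
      rintro t ⟨h1, h2⟩
      obtain ⟨k, hk, hkt⟩ := mem_iUnion₂.1 h1
      obtain ⟨l, hl, hlt⟩ := mem_iUnion₂.1 h2
      exact hJ k (Finset.mem_filter.1 hk).2 l (Finset.mem_filter.1 hl).2 ⟨hkt, hlt⟩

end Circle

/-! ### Attractors of contractions -/

section Attractor

variable {X ι : Type*} [MetricSpace X]

/-- A set that has finite covers by arbitrarily small closed preconnected subsets is locally
connected. -/
theorem locallyConnectedSpace_of_small_preconnected_covers {K : Set X}
    (h : ∀ ε > 0, ∃ 𝒜 : Set (Set X), 𝒜.Finite ∧ ⋃₀ 𝒜 = K ∧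
      ∀ A ∈ 𝒜, IsClosed A ∧ IsPreconnected A ∧ ∀ x ∈ A, ∀ y ∈ A, dist x y < ε) :
    LocallyConnectedSpace K := by
  rw [locallyConnectedSpace_iff_connected_subsets]
  intro x U hU
  obtain ⟨ε, hε, hεU⟩ := Metric.mem_nhds_iff.1 hU
  obtain ⟨𝒜, hfin, hcover, h𝒜⟩ := h ε hε
  have hK : ∀ A ∈ 𝒜, A ⊆ K := fun A hA => hcover ▸ subset_sUnion_of_mem hA
  -- The members through `x` form a neighbourhood because the others have a closed union missing
  -- `x`.
  refine ⟨(↑) ⁻¹' ⋃₀ {A ∈ 𝒜 | (x : X) ∈ A}, ?_, ?_, ?_⟩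
  · have hcl : IsClosed (⋃₀ {A ∈ 𝒜 | (x : X) ∉ A}) :=
      by
      rw [sUnion_eq_biUnion]
      exact (hfin.subset (sep_subset _ _)).isClosed_biUnion fun A hA => (h𝒜 A hA.1).1
    have hx : (x : X) ∉ ⋃₀ {A ∈ 𝒜 | (x : X) ∉ A} := fun ⟨A, hA, hxA⟩ => hA.2 hxA
    filter_upwards [(hcl.preimage continuous_subtype_val).isOpen_compl.mem_nhds hx] with y hy
    obtain ⟨A, hA, hyA⟩ := hcover.ge y.2
    by_cases hxA : (x : X) ∈ A
    · exact ⟨A, ⟨hA, hxA⟩, hyA⟩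
    · exact absurd ⟨A, ⟨hA, hxA⟩, hyA⟩ hy
  · refine IsInducing.subtypeVal.isPreconnected_image.1 ?_
    rw [Subtype.image_preimage_coe,
      inter_eq_right.2 (sUnion_subset fun A hA => hK A hA.1)]
    exact isPreconnected_sUnion (x : X) _ (fun A hA => hA.2) fun A hA => (h𝒜 A hA.1).2.1
  · rintro y ⟨A, ⟨hA, hxA⟩, hyA⟩
    exact hεU ((h𝒜 A hA).2.2 _ hyA _ hxA)

variable {S : ι → X → X} {K : Set X} {q : ℝ}

/-- The attractor of a system of contractions whose pieces are linked is preconnected. -/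
theorem isPreconnected_of_eq_iUnion_image (hq0 : 0 ≤ q) (hq1 : q < 1)
    (hS : ∀ i, ∀ x y, dist (S i x) (S i y) ≤ q * dist x y) (hK : IsCompact K)
    (hKS : K = ⋃ i, S i '' K)
    (hlink : ∀ J : Set ι, (∀ i ∈ J, ∀ j ∉ J, Disjoint (S i '' K) (S j '' K)) →
      J = ∅ ∨ J = univ) : IsPreconnected K := by
  have hSK : ∀ i, ∀ x ∈ K, S i x ∈ K := fun i x hx =>
    hKS ▸ mem_iUnion.2 ⟨i, mem_image_of_mem _ hx⟩
  -- Chain connectedness: a property preserved by jumps of length `q ^ n * diam K` holds everywhere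
  -- on `K` or nowhere. The induction rescales by applying it to `f ∘ S i`.
  have hconst : ∀ n : ℕ, ∀ f : X → Prop,
      (∀ x ∈ K, ∀ y ∈ K, dist x y ≤ q ^ n * Metric.diam K → f x → f y) →
      ∀ x ∈ K, ∀ y ∈ K, f x → f y := by
    intro n
    induction n with
    | zero =>
      intro f hf x hx y hy
      exact hf x hx y hy (by simpa using Metric.dist_le_diam_of_mem hK.isBounded hx hy)
    | succ n ih =>
      intro f hf
      have hi : ∀ i, ∀ x ∈ K, ∀ y ∈ K, f (S i x) → f (S i y) := fun i =>
        ih (fun x => f (S i x)) fun x hx y hy hxy =>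
          hf _ (hSK i x hx) _ (hSK i y hy) <| (hS i x y).trans <| by
            rw [pow_succ', mul_assoc]
            exact mul_le_mul_of_nonneg_left hxy hq0
      -- Each piece satisfies `f` throughout or nowhere, so a common point passes it on to the next
      -- piece.
      have hJ := hlink {i | ∃ x ∈ K, f (S i x)} ?_
      · intro x hx y hy hfx
        obtain ⟨i, x', hx', rfl⟩ := mem_iUnion.1 (hKS.le hx)
        obtain ⟨j, y', hy', rfl⟩ := mem_iUnion.1 (hKS.le hy)
        rcases hJ with h | h
        · exact absurd ⟨x', hx', hfx⟩ (eq_empty_iff_forall_notMem.1 h i)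
        · obtain ⟨z, hz, hfz⟩ := h.ge (mem_univ j)
          exact hi j z hz y' hy' hfz
      · rintro i ⟨x, hx, hfx⟩ j hj
        rw [disjoint_left]
        rintro _ ⟨y, hy, rfl⟩ ⟨z, hz, hyz⟩
        exact hj ⟨z, hz, hyz ▸ hi i x hx y hy hfx⟩
  rw [isPreconnected_iff_subset_of_fully_disjoint_closed hK.isClosed]
  intro u v hu hv huv hdisj
  obtain ⟨δ, hδ, hthick⟩ := (hdisj.mono_left inter_subset_right).exists_thickenings
    (hK.inter_right hu) hv
  obtain ⟨n, hn⟩ : ∃ n : ℕ, q ^ n * Metric.diam K < δ := by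
    have := (tendsto_pow_atTop_nhds_zero_of_lt_one hq0 hq1).mul_const (Metric.diam K)
    rw [zero_mul] at this
    exact (this.eventually (gt_mem_nhds hδ)).exists
  have hf := hconst n (· ∈ u) fun x hx y hy hxy hxu => by
    rcases huv hy with h | h
    · exact h
    · refine absurd ?_ (disjoint_left.1 hthick (?_ : y ∈ _))
      · exact Metric.self_subset_thickening hδ v h
      · exact Metric.mem_thickening_iff.2 ⟨x, ⟨hx, hxu⟩, by rw [dist_comm]; exact hxy.trans_lt hn⟩
  by_cases hKu : ∃ x ∈ K, x ∈ u
  · obtain ⟨x, hx, hxu⟩ := hKu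
    exact Or.inl fun y hy => hf x hx y hy hxu
  · exact Or.inr fun y hy => (huv hy).resolve_left fun h => hKu ⟨y, hy, h⟩

/-- A preconnected attractor of a finite system of contractions is locally connected. -/
theorem locallyConnectedSpace_of_eq_iUnion_image [Finite ι] (hq0 : 0 ≤ q) (hq1 : q < 1)
    (hS : ∀ i, ∀ x y, dist (S i x) (S i y) ≤ q * dist x y) (hK : IsCompact K)
    (hKS : K = ⋃ i, S i '' K) (hconn : IsPreconnected K) : LocallyConnectedSpace K := by
  have hcont : ∀ i, Continuous (S i) := fun i =>
    (LipschitzWith.of_dist_le_mul (K := ⟨q, hq0⟩) (hS i)).continuous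
  -- The cover of level `n` consists of the images of `K` under `n`-fold compositions of the maps.
  have hcover : ∀ n : ℕ, ∃ 𝒜 : Set (Set X), 𝒜.Finite ∧ ⋃₀ 𝒜 = K ∧
      ∀ A ∈ 𝒜, IsCompact A ∧ IsPreconnected A ∧
        ∀ x ∈ A, ∀ y ∈ A, dist x y ≤ q ^ n * Metric.diam K := by
    intro n
    induction n with
    | zero =>
      refine ⟨{K}, finite_singleton K, sUnion_singleton K, ?_⟩
      rintro _ rfl
      exact ⟨hK, hconn, fun x hx y hy => by
        simpa using Metric.dist_le_diam_of_mem hK.isBounded hx hy⟩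
    | succ n ih =>
      obtain ⟨𝒜, hfin, hun, h𝒜⟩ := ih
      refine ⟨⋃ i, image (S i) '' 𝒜, finite_iUnion fun i => hfin.image _, ?_, ?_⟩
      · rw [sUnion_iUnion]
        conv_rhs => rw [hKS]
        refine iUnion_congr fun i => ?_
        rw [← image_sUnion, hun]
      · intro A hA
        obtain ⟨i, A, hA, rfl⟩ := mem_iUnion.1 hA
        obtain ⟨h1, h2, h3⟩ := h𝒜 A ‹A ∈ 𝒜›
        refine ⟨h1.image (hcont i), h2.image _ (hcont i).continuousOn, ?_⟩
        rintro _ ⟨x, hx, rfl⟩ _ ⟨y, hy, rfl⟩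
        refine (hS i x y).trans ?_
        rw [pow_succ', mul_assoc]
        exact mul_le_mul_of_nonneg_left (h3 x hx y hy) hq0
  refine locallyConnectedSpace_of_small_preconnected_covers fun ε hε => ?_
  obtain ⟨n, hn⟩ : ∃ n : ℕ, q ^ n * Metric.diam K < ε := by
    have := (tendsto_pow_atTop_nhds_zero_of_lt_one hq0 hq1).mul_const (Metric.diam K)
    rw [zero_mul] at this
    exact (this.eventually (gt_mem_nhds hε)).exists
  obtain ⟨𝒜, hfin, hun, h𝒜⟩ := hcover n
  exact ⟨𝒜, hfin, hun, fun A hA => ⟨(h𝒜 A hA).1.isClosed, (h𝒜 A hA).2.1,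
    fun x hx y hy => ((h𝒜 A hA).2.2 x hx y hy).trans_lt hn⟩⟩

/-- The attractor of a finite system of contracting similarities whose pieces are separated by
points contains no simple closed curve. -/
theorem PointSeparated.not_exists_simple_closed_curve [Finite ι] (hq0 : 0 ≤ q) (hq1 : q < 1)
    (hS : ∀ i, ∃ r, 0 < r ∧ r ≤ q ∧ ∀ x y, dist (S i x) (S i y) = r * dist x y)
    (hK : IsCompact K) (hKS : K = ⋃ i, S i '' K) (hsep : PointSeparated fun i => S i '' K) :
    ¬ ∃ γ : Circle → X, Continuous γ ∧ Function.Injective γ ∧ range γ ⊆ K := by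
  choose r hr0 hrq hr using hS
  have hcont : ∀ i, Continuous (S i) := fun i =>
    (LipschitzWith.of_dist_le_mul (K := ⟨r i, (hr0 i).le⟩) fun x y => (hr i x y).le).continuous
  have hdist : ∀ n : ℕ, ∀ γ : Circle → X, Continuous γ → Function.Injective γ → range γ ⊆ K →
      ∀ s t, dist (γ s) (γ t) ≤ q ^ n * Metric.diam K := by
    intro n
    induction n with
    | zero =>
      intro γ _ _ hγ s t
      simpa using Metric.dist_le_diam_of_mem hK.isBounded (hγ ⟨s, rfl⟩) (hγ ⟨t, rfl⟩)
    | succ n ih =>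
      intro γ hγ hinj hsub
      obtain ⟨i, hi⟩ := hsep.exists_range_subset (fun i => (hK.image (hcont i)).isClosed) hγ hinj
        (hsub.trans hKS.le)
      -- The pullback of `γ` along `S i`; it is continuous because `S i` scales distances by a
      -- positive factor.
      choose η hηK hη using fun t => hi (mem_range_self t)
      have hd : ∀ s t, dist (γ s) (γ t) = r i * dist (η s) (η t) := fun s t => by
        rw [← hη, ← hη, hr]
      have hηc : Continuous η := by
        refine Metric.continuous_iff'.2 fun t ε hε => ?_
        filter_upwards [Metric.continuous_iff'.1 hγ t (r i * ε) (mul_pos (hr0 i) hε)] with s hs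
        rw [hd] at hs
        exact lt_of_mul_lt_mul_left hs (hr0 i).le
      have hηi : Function.Injective η := fun s t hst => hinj (by rw [← hη, ← hη, hst])
      intro s t
      rw [hd, pow_succ', mul_assoc]
      exact mul_le_mul (hrq i) (ih η hηc hηi (range_subset_iff.2 hηK) s t) dist_nonneg hq0
  rintro ⟨γ, hγ, hinj, hsub⟩
  obtain ⟨s, t, hst⟩ := exists_pair_ne Circle
  have hlim := (tendsto_pow_atTop_nhds_zero_of_lt_one hq0 hq1).mul_const (Metric.diam K)
  rw [zero_mul] at hlim
  have := ge_of_tendsto' hlim fun n => hdist n γ hγ hinj hsub s t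
  exact hst (hinj (dist_le_zero.1 this))

end Attractor

/-! ### Topology of the polygons -/

section Polygonal

theorem PolygonalDisk.isCompact_carrier (P : PolygonalDisk) : IsCompact P.carrier := by
  obtain ⟨e⟩ := P.homeomorphic_disk
  have := isCompact_iff_compactSpace.1 (isCompact_closedBall (0 : ℂ) 1)
  exact isCompact_iff_compactSpace.2 e.symm.compactSpace

theorem PolygonalDisk.isConnected_carrier (P : PolygonalDisk) : IsConnected P.carrier := by
  obtain ⟨e⟩ := P.homeomorphic_disk
  have : ConnectedSpace (Metric.closedBall (0 : ℂ) 1) := isConnected_iff_connectedSpace.1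
    ⟨⟨0, by simp⟩, (convex_closedBall (0 : ℂ) 1).isPreconnected⟩
  exact isConnected_iff_connectedSpace.2
    (e.symm.surjective.connectedSpace e.symm.continuous)

/-- The members of a finite closed cover of a preconnected set are linked. -/
theorem IsPreconnected.eq_empty_or_eq_univ_of_disjoint {X ι : Type*} [TopologicalSpace X]
    [Finite ι] {Q : ι → Set X} (h : IsPreconnected (⋃ i, Q i)) (hcl : ∀ i, IsClosed (Q i))
    (hne : ∀ i, (Q i).Nonempty) {J : Set ι} (hJ : ∀ i ∈ J, ∀ j ∉ J, Disjoint (Q i) (Q j)) :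
    J = ∅ ∨ J = univ := by
  have hdisj : Disjoint (⋃ i ∈ J, Q i) (⋃ j ∈ Jᶜ, Q j) := by
    simp only [disjoint_iUnion_left, disjoint_iUnion_right]
    exact fun j hj i hi => hJ i hi j hj
  rcases isPreconnected_iff_subset_of_disjoint_closed.1 h (⋃ i ∈ J, Q i) (⋃ j ∈ Jᶜ, Q j)
    ((toFinite J).isClosed_biUnion fun i _ => hcl i)
    ((toFinite Jᶜ).isClosed_biUnion fun i _ => hcl i)
    (iUnion_subset fun i => by
      by_cases hi : i ∈ J
      · exact (subset_biUnion_of_mem (u := Q) hi).trans subset_union_left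
      · exact (subset_biUnion_of_mem (u := Q) (show i ∈ Jᶜ from hi)).trans subset_union_right)
    (by rw [hdisj.inter_eq, inter_empty]) with hu | hu
  · refine Or.inr (eq_univ_of_forall fun j => by_contra fun hj => ?_)
    obtain ⟨x, hx⟩ := hne j
    exact disjoint_left.1 hdisj (hu (mem_iUnion.2 ⟨j, hx⟩))
      (mem_iUnion₂.2 ⟨j, hj, hx⟩)
  · refine Or.inl (eq_empty_of_forall_notMem fun j hj => ?_)
    obtain ⟨x, hx⟩ := hne j
    exact disjoint_right.1 hdisj (hu (mem_iUnion.2 ⟨j, hx⟩))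
      (mem_iUnion₂.2 ⟨j, hj, hx⟩)

end Polygonal

theorem theorem9 {m : ℕ} (P : PolygonalDisk) (S : Fin m → ℂ → ℂ)
    (hS : IsGeneralizedPolygonalSystem P S) (K : Set ℂ) (hK : IsAttractor S K)
    (hinter : ∀ i j : Fin m, i ≠ j →
      S i '' K ∩ S j '' K = S i '' P.carrier ∩ S j '' P.carrier) :
    IsDendrite K := by
  choose r hr0 hr1 hr using hS.similarity
  -- The largest ratio; there is at least one map because `K` is nonempty.
  obtain ⟨q, hq0, hq1, hrq⟩ : ∃ q : ℝ, 0 ≤ q ∧ q < 1 ∧ ∀ i, r i ≤ q := by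
    obtain ⟨x, hx⟩ := hK.nonempty
    obtain ⟨i, -⟩ := mem_iUnion.1 (hK.eq_iUnion.le hx)
    obtain ⟨j, -, hj⟩ := Finset.exists_max_image Finset.univ r ⟨i, Finset.mem_univ i⟩
    exact ⟨r j, (hr0 j).le, hr1 j, fun i => hj i (Finset.mem_univ i)⟩
  have hlip : ∀ i, ∀ x y, dist (S i x) (S i y) ≤ q * dist x y := fun i x y => by
    rw [hr]
    exact mul_le_mul_of_nonneg_right (hrq i) dist_nonneg
  have hcont : ∀ i, Continuous (S i) := fun i =>
    (LipschitzWith.of_dist_le_mul (K := ⟨q, hq0⟩) (hlip i)).continuous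
  have hcl : ∀ i, IsClosed (S i '' P.carrier) := fun i =>
    (P.isCompact_carrier.image (hcont i)).isClosed
  have hconn : ∀ i, IsConnected (S i '' P.carrier) := fun i =>
    P.isConnected_carrier.image _ (hcont i).continuousOn
  have hsepP : PointSeparated fun i => S i '' P.carrier :=
    pointSeparated_of_contractible_iUnion hcl hconn hS.contractible fun i j hij => by
      rw [hS.inter_eq i j hij]
      exact hS.common_vertices i j hij
  -- The split `J` found for the polygons serves for `K`, as indices on opposite sides are distinct.
  have hsepK : PointSeparated fun i => S i '' K := by
    intro i j hij
    obtain ⟨J, hj, hi, T, hT, hJ⟩ := hsepP i j hij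
    refine ⟨J, hj, hi, T, hT, fun k hk l hl => ?_⟩
    have hkl : k ≠ l := fun h => hl (h ▸ hk)
    exact (hinter k l hkl).le.trans (hJ k hk l hl)
  have hunion : IsPreconnected (⋃ i, S i '' P.carrier) := by
    have := hS.contractible
    exact isPreconnected_iff_preconnectedSpace.2 inferInstance
  have hKconn : IsPreconnected K :=
    isPreconnected_of_eq_iUnion_image hq0 hq1 hlip hK.isCompact hK.eq_iUnion fun J hJ =>
      hunion.eq_empty_or_eq_univ_of_disjoint hcl (fun i => (hconn i).nonempty) fun i hi j hj => by
        have hij : i ≠ j := fun h => hj (h ▸ hi)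
        rw [disjoint_iff_inter_eq_empty, ← hinter i j hij, ← disjoint_iff_inter_eq_empty]
        exact hJ i hi j hj
  exact ⟨hK.isCompact, ⟨hK.nonempty, hKconn⟩,
    locallyConnectedSpace_of_eq_iUnion_image hq0 hq1 hlip hK.isCompact hK.eq_iUnion hKconn,
    hsepK.not_exists_simple_closed_curve hq0 hq1 (fun i => ⟨r i, hr0 i, hrq i, hr i⟩)
      hK.isCompact hK.eq_iUnion⟩
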